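/- Let $G$ be an infinite compact (Hausdorff) abelian group with normalized (regular) Haar measure $\mu$ on its Borel $\sigma$-algebra, and let $L^0(G)$ be the space of complex-valued Borel measurable functions on $G$, modulo equality $\mu$-a.e. A Banach function space over $G$ is a Banach space $(E,\|\cdot\|_E)$, where $E\subseteq L^0(G)$ is a linear subspace such that $f\in E$ whenever $f\in L^0(G)$, $g\in E$ and $|f|\le|g|$ a.e., and such that $\|f\|_E\le\|g\|_E$ whenever $f,g\in E$ and $|f|\le|g|$ a.e. It is translation invariant if for all $f\in E$ and $y\in G$ the function $\tau_yf(x)=f(x-y)$ belongs to $E$ and $\|\tau_yf\|_E=\|f\|_E$. Its Köthe dual is $E^\times=\{g\in L^0(G):\|g\|_{E^\times}<\infty\}$ with the norm $\|g\|_{E^\times}=\sup\{\int_G|fg|\,d\mu: f\in E,\ \|f\|_E\le1\}$. The space $E$ has the Fatou property if for every upwards directed net $0\le u_\alpha\uparrow$ in $E$ with $\sup_\alpha\|u_\alpha\|_E<\infty$ there is $u\in E$ with $u_\alpha\uparrow u$ and $\|u_\alpha\|_E\uparrow\|u\|_E$. Let $E\neq\{0\}$ be a translation invariant Banach function space over $G$.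 (i) With continuous inclusions, $L^\infty(G)\subseteq E^\times\subseteq L^1(G)$. (ii) If, in addition, $E$ has the Fatou property, then, with continuous inclusions, $L^\infty(G)\subseteq E\subseteq L^1(G)$. -/

import Mathlib

open MeasureTheory
open scoped ENNReal ComplexOrder

universe u

noncomputable section

/-- A linear space of (classes modulo a.e. equality of) complex measurable functions, together
with a seminorm on it. This is the common type of Banach function spaces, of the spaces `L^p` and
of Köthe duals. -/
structure SeminormedFunctionSpace {Ω : Type u} [MeasurableSpace Ω] (μ : Measure Ω) where
  toSubmodule : Submodule ℂ (Ω →ₘ[μ] ℂ)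
  seminorm : Seminorm ℂ toSubmodule

namespace SeminormedFunctionSpace

variable {Ω : Type u} [MeasurableSpace Ω] {μ : Measure Ω}

/-- The (semi)norm, metric and topology on the space that are given by its seminorm. -/
instance instSeminormedAddCommGroup (F : SeminormedFunctionSpace μ) :
    SeminormedAddCommGroup F.toSubmodule :=
  F.seminorm.toAddGroupSeminorm.toSeminormedAddCommGroup

theorem norm_def (F : SeminormedFunctionSpace μ) (f : F.toSubmodule) : ‖f‖ = F.seminorm f := rfl

instance instNormedSpace (F : SeminormedFunctionSpace μ) : NormedSpace ℂ F.toSubmodule where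
  norm_smul_le c f := (map_smul_eq_mul F.seminorm c f).le

/-- `E ⊆ F` with a continuous inclusion map. -/
def ContinuouslyIncluded (E F : SeminormedFunctionSpace μ) : Prop :=
  ∃ h : E.toSubmodule ≤ F.toSubmodule, Continuous (Submodule.inclusion h)

/-- `E` is a Banach function space over `(Ω, Σ, μ)`: an order ideal of `L⁰(μ)` with an absolutely
monotone norm for which it is complete. -/
structure IsBanachFunctionSpace (E : SeminormedFunctionSpace μ) : Prop where
  /-- The seminorm is a norm. -/
  eq_zero_of_norm_eq_zero : ∀ f : E.toSubmodule, ‖f‖ = 0 → f = 0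
  /-- The space is an order ideal. -/
  mem_of_abs_le : ∀ f g : Ω →ₘ[μ] ℂ,
    g ∈ E.toSubmodule → (∀ᵐ x ∂μ, ‖f x‖ ≤ ‖g x‖) → f ∈ E.toSubmodule
  /-- The norm is absolutely monotone. -/
  norm_le_of_abs_le : ∀ f g : E.toSubmodule,
    (∀ᵐ x ∂μ, ‖(f : Ω →ₘ[μ] ℂ) x‖ ≤ ‖(g : Ω →ₘ[μ] ℂ) x‖) → ‖f‖ ≤ ‖g‖
  /-- The space is complete. -/
  completeSpace : CompleteSpace E.toSubmodule

end SeminormedFunctionSpace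

section Lp

variable {Ω : Type u} [MeasurableSpace Ω]

/-- The space `L^p(μ)`, `1 ≤ p ≤ ∞`, with its usual norm. -/
def lpFunctionSpace (p : ℝ≥0∞) [Fact (1 ≤ p)] (μ : Measure Ω) : SeminormedFunctionSpace μ where
  toSubmodule := Lp.LpSubmodule ℂ ℂ p μ
  seminorm := Seminorm.of (fun f => (eLpNorm (f : Ω →ₘ[μ] ℂ) p μ).toReal)
    (fun f g => by
      have := norm_add_le (⟨f.1, f.2⟩ : Lp ℂ p μ) ⟨g.1, g.2⟩
      rwa [Lp.norm_def, Lp.norm_def, Lp.norm_def] at this)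
    (fun c f => by
      have := norm_smul c (⟨f.1, f.2⟩ : Lp ℂ p μ)
      rwa [Lp.norm_def, Lp.norm_def] at this)

end Lp

namespace SeminormedFunctionSpace

variable {Ω : Type u} [MeasurableSpace Ω] {μ : Measure Ω}

/-- `‖g‖_{E^×} = sup {∫ |f g| dμ : f ∈ E, ‖f‖_E ≤ 1} ∈ [0, ∞]`, for every `g ∈ L⁰(μ)`. -/
def kotheNorm (E : SeminormedFunctionSpace μ) (g : Ω →ₘ[μ] ℂ) : ℝ≥0∞ :=
  ⨆ (f : E.toSubmodule) (_ : ‖f‖ ≤ 1), ∫⁻ x, ‖(f : Ω →ₘ[μ] ℂ) x * g x‖ₑ ∂μ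

theorem kotheNorm_zero (E : SeminormedFunctionSpace μ) : E.kotheNorm 0 = 0 := by
  refine le_antisymm (iSup₂_le fun f _ => ?_) bot_le
  rw [lintegral_congr_ae (g := fun _ => 0)]
  · simp
  · filter_upwards [AEEqFun.coeFn_zero (α := Ω) (β := ℂ) (μ := μ)] with x hx
    simp [hx]

theorem kotheNorm_add_le (E : SeminormedFunctionSpace μ) (g h : Ω →ₘ[μ] ℂ) :
    E.kotheNorm (g + h) ≤ E.kotheNorm g + E.kotheNorm h := by
  refine iSup₂_le fun f hf => ?_
  calc ∫⁻ x, ‖(f : Ω →ₘ[μ] ℂ) x * (g + h : Ω →ₘ[μ] ℂ) x‖ₑ ∂μ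
      ≤ ∫⁻ x, (‖(f : Ω →ₘ[μ] ℂ) x * g x‖ₑ + ‖(f : Ω →ₘ[μ] ℂ) x * h x‖ₑ) ∂μ := by
        refine lintegral_mono_ae ?_
        filter_upwards [AEEqFun.coeFn_add g h] with x hx
        rw [hx, Pi.add_apply, mul_add]
        exact enorm_add_le _ _
    _ = ∫⁻ x, ‖(f : Ω →ₘ[μ] ℂ) x * g x‖ₑ ∂μ + ∫⁻ x, ‖(f : Ω →ₘ[μ] ℂ) x * h x‖ₑ ∂μ :=
        lintegral_add_left (((f : Ω →ₘ[μ] ℂ).measurable.mul g.measurable).enorm) _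
    _ ≤ E.kotheNorm g + E.kotheNorm h := by
        unfold kotheNorm
        gcongr
        · exact le_iSup₂ (f := fun (f : E.toSubmodule) (_ : ‖f‖ ≤ 1) =>
            ∫⁻ x, ‖(f : Ω →ₘ[μ] ℂ) x * g x‖ₑ ∂μ) f hf
        · exact le_iSup₂ (f := fun (f : E.toSubmodule) (_ : ‖f‖ ≤ 1) =>
            ∫⁻ x, ‖(f : Ω →ₘ[μ] ℂ) x * h x‖ₑ ∂μ) f hf

theorem kotheNorm_smul (E : SeminormedFunctionSpace μ) (c : ℂ) (g : Ω →ₘ[μ] ℂ) :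
    E.kotheNorm (c • g) = ‖c‖ₑ * E.kotheNorm g := by
  unfold kotheNorm
  simp_rw [ENNReal.mul_iSup]
  refine iSup_congr fun f => iSup_congr fun _ => ?_
  have hm : Measurable fun x => ‖(f : Ω →ₘ[μ] ℂ) x * g x‖ₑ :=
    ((f : Ω →ₘ[μ] ℂ).measurable.mul g.measurable).enorm
  rw [← lintegral_const_mul _ hm]
  refine lintegral_congr_ae ?_
  filter_upwards [AEEqFun.coeFn_smul c g] with x hx
  rw [hx, Pi.smul_apply, smul_eq_mul, ← enorm_mul]
  congr 1
  ring

/-- The Köthe dual `E^× = {g ∈ L⁰(μ) : ‖g‖_{E^×} < ∞}` with the norm `‖·‖_{E^×}`. -/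
def kotheDual (E : SeminormedFunctionSpace μ) : SeminormedFunctionSpace μ where
  toSubmodule :=
    { carrier := {g | E.kotheNorm g < ∞}
      add_mem' := fun {g h} hg hh =>
        (E.kotheNorm_add_le g h).trans_lt (ENNReal.add_lt_top.2 ⟨hg, hh⟩)
      zero_mem' := by
        change E.kotheNorm 0 < ∞
        rw [kotheNorm_zero]
        exact ENNReal.zero_lt_top
      smul_mem' := fun c g hg => by
        change E.kotheNorm (c • g) < ∞
        rw [kotheNorm_smul]
        exact ENNReal.mul_lt_top enorm_lt_top hg }
  seminorm := Seminorm.of (fun g => (E.kotheNorm (g : Ω →ₘ[μ] ℂ)).toReal)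
    (fun g h => by
      rw [← ENNReal.toReal_add (ne_of_lt g.2) (ne_of_lt h.2)]
      exact ENNReal.toReal_mono (ENNReal.add_ne_top.2 ⟨ne_of_lt g.2, ne_of_lt h.2⟩)
        (E.kotheNorm_add_le _ _))
    (fun c g => by
      change (E.kotheNorm (c • (g : Ω →ₘ[μ] ℂ))).toReal = _
      rw [kotheNorm_smul, ENNReal.toReal_mul, toReal_enorm])

/-- The Fatou property: every increasing net `0 ≤ v_i` in `E` with bounded norms has a supremum
`w ∈ E`, and `‖v_i‖ ↑ ‖w‖`. The order on `ℂ`-valued functions is `f ≤ g` iff `g - f` is real and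
nonnegative a.e.; index sets in the universe of `Ω` suffice, since the range of an
increasing net is itself a directed subset of `L⁰(μ)`. -/
def FatouProperty (E : SeminormedFunctionSpace μ) : Prop :=
  ∀ (ι : Type u) [Preorder ι] [IsDirectedOrder ι] [Nonempty ι] (v : ι → E.toSubmodule),
    (∀ i, (0 : Ω →ₘ[μ] ℂ) ≤ v i) →
    (∀ i j, i ≤ j → (v i : Ω →ₘ[μ] ℂ) ≤ v j) →
    BddAbove (Set.range fun i => ‖v i‖) →
    ∃ w : E.toSubmodule, IsLUB (Set.range fun i => (v i : Ω →ₘ[μ] ℂ)) w ∧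
      IsLUB (Set.range fun i => ‖v i‖) ‖w‖

end SeminormedFunctionSpace

section Translation

variable {G : Type u} [AddCommGroup G] [TopologicalSpace G] [IsTopologicalAddGroup G]
  [MeasurableSpace G] [BorelSpace G] {μ : Measure G} [μ.IsAddHaarMeasure]

/-- The translation operator `(τ_y f)(x) = f(x - y)` on `L⁰(G)`. -/
def translateL0 (y : G) (f : G →ₘ[μ] ℂ) : G →ₘ[μ] ℂ :=
  f.compMeasurePreserving (fun x => x - y) (measurePreserving_sub_right μ y)

/-- `τ_y f ∈ E` and `‖τ_y f‖_E = ‖f‖_E` for all `f ∈ E` and `y ∈ G`. -/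
def SeminormedFunctionSpace.TranslationInvariant (E : SeminormedFunctionSpace μ) : Prop :=
  ∀ (y : G) (f : E.toSubmodule),
    ∃ h : translateL0 y (f : G →ₘ[μ] ℂ) ∈ E.toSubmodule,
      ‖(⟨translateL0 y (f : G →ₘ[μ] ℂ), h⟩ : E.toSubmodule)‖ = ‖f‖

end Translation

end

open Filter Topology

/-! ### Averaging translates in `L¹` -/

section Averaging

variable {G : Type u} [AddCommGroup G] [TopologicalSpace G] [IsTopologicalAddGroup G]
  [MeasurableSpace G] [BorelSpace G]

/-! Translation need not be continuous in `E`, but it is in `L¹`, so the translates of an integrable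
`h` can be averaged there by a Bochner integral. The average is the constant `∫ h`, which is
therefore an a.e. limit of convex combinations of translates; if `h` is a bounded function in `E`,
invariance keeps their `E`-norms at most `‖h‖`. This is
`TranslationInvariant.exists_seq_tendsto_ae`, and it is used three times.

Completeness makes the unit ball of `E` bounded in measure: `|f| ≤ M` on a set of measure at least
`1/2`. Averaging truncations of `|f|` gives `∫ |f| ≤ M`. Hence `E ⊆ L¹` (even without the Fatou
property) and `L^∞ ⊆ E^×`.

A nonzero `E` contains a bounded `e ≥ 0` with `c = ∫ e > 0`, and averages `a n` of `e` tend to `c`.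
Fatou's lemma gives `c ∫ |g| ≤ ‖e‖ ‖g‖_{E^×}`, so `E^× ⊆ L¹`.

Under the Fatou property the tail infima of `|a n|` are dominated by some `w ∈ E`; then `|w| ≥ c`,
so `L^∞ ⊆ E`. -/

theorem continuous_translateLp [T2Space G] [CompactSpace G] {μ : Measure G} [μ.IsAddHaarMeasure]
    [μ.Regular] (h : Lp ℂ 1 μ) :
    Continuous fun y : G =>
      Lp.compMeasurePreserving (fun x => x - y) (measurePreserving_sub_right μ y) h := by
  have hg : Continuous fun y : G => (⟨fun x => x - y, by fun_prop⟩ : C(G, G)) :=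
    ContinuousMap.continuous_of_continuous_uncurry _ (by
      change Continuous fun p : G × G => p.2 - p.1
      fun_prop)
  exact (continuous_const (y := h)).compMeasurePreservingLp hg
    (fun y => measurePreserving_sub_right μ y) ENNReal.one_ne_top

/-- The average of all translates of an integrable function is the constant with value its
integral. -/
theorem integral_translateLp [T2Space G] [CompactSpace G] (μ : Measure G) [μ.IsAddHaarMeasure]
    [μ.Regular] [IsProbabilityMeasure μ] (h : Lp ℂ 1 μ) :
    ∫ y, Lp.compMeasurePreserving (fun x => x - y) (measurePreserving_sub_right μ y) h ∂μ =
      Lp.const 1 μ (∫ x, h x ∂μ) := by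
  have hint (h : Lp ℂ 1 μ) : Integrable (fun y : G =>
      Lp.compMeasurePreserving (fun x => x - y) (measurePreserving_sub_right μ y) h) μ :=
    (continuous_translateLp h).integrable_of_hasCompactSupport (HasCompactSupport.of_compactSpace _)
  -- Both sides are continuous in `h`, the left one being 1-Lipschitz because translations are
  -- isometries. So continuous functions suffice, and for them the average can be taken in `C(G, ℂ)`
  -- and evaluated pointwise.
  have hcl : IsClosed {h : Lp ℂ 1 μ |
      ∫ y, Lp.compMeasurePreserving (fun x => x - y) (measurePreserving_sub_right μ y) h ∂μ =
        Lp.const 1 μ (∫ x, h x ∂μ)} := by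
    refine isClosed_eq ?_ ?_
    · refine LipschitzWith.continuous (K := 1) (LipschitzWith.of_dist_le_mul fun f g => ?_)
      rw [dist_eq_norm, dist_eq_norm, ← integral_sub (hint f) (hint g)]
      refine (norm_integral_le_of_norm_le_const (C := ‖f - g‖) (ae_of_all _ fun y => ?_)).trans ?_
      · rw [← map_sub, Lp.norm_compMeasurePreserving]
      · simp
    · exact (Lp.constL 1 μ ℂ (E := ℂ)).continuous.comp continuous_integral
  refine (ContinuousMap.toLp_denseRange (E := ℂ) (μ := μ) ℂ ENNReal.one_ne_top).induction_on
    (p := fun h : Lp ℂ 1 μ =>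
      ∫ y, Lp.compMeasurePreserving (fun x => x - y) (measurePreserving_sub_right μ y) h ∂μ =
        Lp.const 1 μ (∫ x, h x ∂μ)) h hcl fun φ => ?_
  have hT : Continuous fun y : G => (⟨fun x => φ (x - y), by fun_prop⟩ : C(G, ℂ)) :=
    ContinuousMap.continuous_of_continuous_uncurry _ (by
      change Continuous fun p : G × G => φ (p.2 - p.1)
      fun_prop)
  have hTi := hT.integrable_of_hasCompactSupport (μ := μ) (HasCompactSupport.of_compactSpace _)
  have heq (y : G) : Lp.compMeasurePreserving (fun x => x - y) (measurePreserving_sub_right μ y)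
      (ContinuousMap.toLp 1 μ ℂ φ) =
        ContinuousMap.toLp 1 μ ℂ (⟨fun x => φ (x - y), by fun_prop⟩ : C(G, ℂ)) := rfl
  simp_rw [heq]
  rw [ContinuousLinearMap.integral_comp_comm _ hTi,
    integral_congr_ae (ContinuousMap.coeFn_toLp (p := 1) (𝕜 := ℂ) μ φ)]
  have hconst : ∫ y, (⟨fun x => φ (x - y), by fun_prop⟩ : C(G, ℂ)) ∂μ =
      ContinuousMap.const G (∫ x, φ x ∂μ) := by
    ext x
    rw [← ContinuousMap.evalCLM_apply (R := ℝ), ← ContinuousLinearMap.integral_comp_comm _ hTi]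
    exact integral_sub_left_eq_self (fun z => φ z) μ x
  rw [hconst]
  rfl

/-- A convex set of integrable functions that contains all translates of `h` contains a sequence
that converges a.e. to the constant `∫ h`. -/
theorem exists_seq_tendsto_ae_integral [T2Space G] [CompactSpace G] {μ : Measure G}
    [μ.IsAddHaarMeasure] [μ.Regular] [IsProbabilityMeasure μ] {S : Set (Lp ℂ 1 μ)}
    (hS : Convex ℝ S) (h : Lp ℂ 1 μ)
    (hmem : ∀ y, Lp.compMeasurePreserving (fun x => x - y) (measurePreserving_sub_right μ y) h ∈ S) :
    ∃ a : ℕ → Lp ℂ 1 μ, (∀ n, a n ∈ S) ∧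
      ∀ᵐ x ∂μ, Tendsto (fun n => a n x) atTop (𝓝 (∫ x, h x ∂μ)) := by
  have hcl : Lp.const 1 μ (∫ x, h x ∂μ) ∈ closure S := by
    rw [← integral_translateLp]
    exact hS.closure.integral_mem isClosed_closure (ae_of_all _ fun y => subset_closure (hmem y))
      ((continuous_translateLp h).integrable_of_hasCompactSupport
        (HasCompactSupport.of_compactSpace _))
  obtain ⟨a, ha, hlim⟩ := mem_closure_iff_seq_limit.1 hcl
  obtain ⟨ns, -, hns⟩ := (tendstoInMeasure_of_tendsto_Lp hlim).exists_seq_tendsto_ae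
  refine ⟨fun n => a (ns n), fun n => ha _, ?_⟩
  filter_upwards [hns, Lp.coeFn_const (p := 1) (μ := μ) (∫ x, h x ∂μ)] with x hx hc
  rw [hc] at hx
  exact hx

end Averaging

/-! ### Banach function spaces without translation structure -/

namespace SeminormedFunctionSpace

variable {Ω : Type u} [MeasurableSpace Ω] {μ : Measure Ω} {E : SeminormedFunctionSpace μ}

theorem lpFunctionSpace_one_norm (f : (lpFunctionSpace 1 μ).toSubmodule) :
    ‖f‖ = (∫⁻ x, ‖(f : Ω →ₘ[μ] ℂ) x‖ₑ ∂μ).toReal := by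
  rw [← eLpNorm_one_eq_lintegral_enorm]
  rfl

theorem mem_lpFunctionSpace_one {f : Ω →ₘ[μ] ℂ} (h : ∫⁻ x, ‖f x‖ₑ ∂μ < ∞) :
    f ∈ (lpFunctionSpace 1 μ).toSubmodule :=
  Lp.mem_Lp_iff_eLpNorm_lt_top.2 (by rwa [eLpNorm_one_eq_lintegral_enorm])

theorem ae_norm_le_lpFunctionSpace_top (f : (lpFunctionSpace ∞ μ).toSubmodule) :
    ∀ᵐ x ∂μ, ‖(f : Ω →ₘ[μ] ℂ) x‖ ≤ ‖f‖ := by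
  filter_upwards [ae_le_eLpNormEssSup (f := (f : Ω →ₘ[μ] ℂ)) (μ := μ)] with x hx
  rw [← eLpNorm_exponent_top] at hx
  have h := ENNReal.toReal_mono (Lp.mem_Lp_iff_eLpNorm_lt_top.1 f.2).ne hx
  rwa [toReal_enorm] at h

theorem norm_kotheDual (g : E.kotheDual.toSubmodule) :
    ‖g‖ = (E.kotheNorm (g : Ω →ₘ[μ] ℂ)).toReal := rfl

theorem continuouslyIncluded_of_bound {F : SeminormedFunctionSpace μ}
    (h : E.toSubmodule ≤ F.toSubmodule) (C : ℝ)
    (hC : ∀ f : E.toSubmodule, ‖Submodule.inclusion h f‖ ≤ C * ‖f‖) :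
    E.ContinuouslyIncluded F :=
  ⟨h, AddMonoidHomClass.continuous_of_bound (Submodule.inclusion h) C hC⟩

theorem IsBanachFunctionSpace.exists_ae_eq (hB : E.IsBanachFunctionSpace) {φ : Ω → ℂ}
    (hφ : Measurable φ) (g : E.toSubmodule)
    (h : ∀ᵐ x ∂μ, ‖φ x‖ ≤ ‖(g : Ω →ₘ[μ] ℂ) x‖) :
    ∃ f : E.toSubmodule, (f : Ω →ₘ[μ] ℂ) =ᵐ[μ] φ ∧ ‖f‖ ≤ ‖g‖ := by
  have hm := AEEqFun.coeFn_mk φ (hφ.aestronglyMeasurable (μ := μ))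
  have hle : ∀ᵐ x ∂μ, ‖AEEqFun.mk φ (hφ.aestronglyMeasurable (μ := μ)) x‖ ≤
      ‖(g : Ω →ₘ[μ] ℂ) x‖ := by
    filter_upwards [hm, h] with x hx hx'
    rwa [hx]
  have hmem := hB.mem_of_abs_le _ _ g.2 hle
  exact ⟨⟨_, hmem⟩, hm, hB.norm_le_of_abs_le ⟨_, hmem⟩ g hle⟩

/-- The excess `(|t| - |f|)⁺` is at most `|s n - f|` for large `n`, so it lies in `E` with norm at
most `‖s n - f‖ → 0`, and vanishes. -/
theorem IsBanachFunctionSpace.abs_le_of_tendsto (hB : E.IsBanachFunctionSpace)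
    {s : ℕ → E.toSubmodule} {f : E.toSubmodule} (hs : Tendsto s atTop (𝓝 f)) (t : Ω →ₘ[μ] ℂ)
    (ht : ∀ᶠ n in atTop, ∀ᵐ x ∂μ, ‖t x‖ ≤ ‖(s n : Ω →ₘ[μ] ℂ) x‖) :
    ∀ᵐ x ∂μ, ‖t x‖ ≤ ‖(f : Ω →ₘ[μ] ℂ) x‖ := by
  have key : ∀ᶠ n in atTop, ∀ᵐ x ∂μ,
      ‖((max 0 (‖t x‖ - ‖(f : Ω →ₘ[μ] ℂ) x‖) : ℝ) : ℂ)‖ ≤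
        ‖((s n - f : E.toSubmodule) : Ω →ₘ[μ] ℂ) x‖ := by
    filter_upwards [ht] with n hn
    filter_upwards [hn, AEEqFun.coeFn_sub (s n : Ω →ₘ[μ] ℂ) (f : Ω →ₘ[μ] ℂ)] with x hx hsub
    rw [Submodule.coe_sub, hsub, Complex.norm_real, Real.norm_of_nonneg (le_max_left _ _)]
    have := norm_sub_norm_le ((s n : Ω →ₘ[μ] ℂ) x) ((f : Ω →ₘ[μ] ℂ) x)
    exact max_le (norm_nonneg _) (by simpa using by linarith)
  have hφ : Measurable fun x => ((max 0 (‖t x‖ - ‖(f : Ω →ₘ[μ] ℂ) x‖) : ℝ) : ℂ) :=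
    Complex.measurable_ofReal.comp
      (measurable_const.max (t.measurable.norm.sub (f : Ω →ₘ[μ] ℂ).measurable.norm))
  obtain ⟨n₀, hn₀⟩ := key.exists
  obtain ⟨p, hp, -⟩ := hB.exists_ae_eq hφ _ hn₀
  have hle : ∀ᶠ n in atTop, ‖p‖ ≤ ‖s n - f‖ := by
    filter_upwards [key] with n hn
    refine hB.norm_le_of_abs_le _ _ ?_
    filter_upwards [hn, hp] with x hx hpx
    rwa [hpx]
  have hp0 : p = 0 := hB.eq_zero_of_norm_eq_zero p (le_antisymm
    (ge_of_tendsto (tendsto_iff_norm_sub_tendsto_zero.1 hs) hle) (norm_nonneg _))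
  subst hp0
  filter_upwards [hp, AEEqFun.coeFn_zero (α := Ω) (β := ℂ) (μ := μ)] with x hx h0
  rw [Submodule.coe_zero, h0, Pi.zero_apply, eq_comm, Complex.ofReal_eq_zero] at hx
  have := le_max_right 0 (‖t x‖ - ‖(f : Ω →ₘ[μ] ℂ) x‖)
  linarith

theorem coeFn_sum_smul {s : ℕ → E.toSubmodule} {φ : ℕ → Ω → ℝ}
    (hs : ∀ n, (s n : Ω →ₘ[μ] ℂ) =ᵐ[μ] fun x => (φ n x : ℂ)) (c : ℕ → ℝ) (N : ℕ) :
    ((∑ n ∈ Finset.range N, (c n : ℂ) • s n : E.toSubmodule) : Ω →ₘ[μ] ℂ) =ᵐ[μ]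
      fun x => ((∑ n ∈ Finset.range N, c n * φ n x : ℝ) : ℂ) := by
  induction N with
  | zero =>
    filter_upwards [AEEqFun.coeFn_zero (α := Ω) (β := ℂ) (μ := μ)] with x hx
    simpa using hx
  | succ N ih =>
    rw [Finset.sum_range_succ, Submodule.coe_add, Submodule.coe_smul]
    filter_upwards [ih, hs N, AEEqFun.coeFn_smul (c N : ℂ) (s N : Ω →ₘ[μ] ℂ),
      AEEqFun.coeFn_add ((∑ n ∈ Finset.range N, (c n : ℂ) • s n : E.toSubmodule) : Ω →ₘ[μ] ℂ)
        ((c N : ℂ) • (s N : Ω →ₘ[μ] ℂ))] with x h1 h2 h3 h4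
    rw [h4, Pi.add_apply, h1, h3, Pi.smul_apply, h2, Finset.sum_range_succ]
    simp

/-- The unit ball of a Banach function space over a probability space is bounded in measure. -/
theorem IsBanachFunctionSpace.exists_measure_le_half [IsProbabilityMeasure μ]
    (hB : E.IsBanachFunctionSpace) :
    ∃ M : ℝ, 0 ≤ M ∧ ∀ f : E.toSubmodule, ‖f‖ ≤ 1 →
      μ {x | M < ‖(f : Ω →ₘ[μ] ℂ) x‖} ≤ 1 / 2 := by
  by_contra! hcon
  -- Thresholds `4 ^ n` beat the summable weights `2 ^ (-n)`: the sum `F` of the weighted `|f n|`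
  -- satisfies `|F| ≥ 2 ^ n` on a set of measure at least `1/2`, for every `n`. By continuity from
  -- above, `F` would be infinite on a set of positive measure.
  choose f hf1 hf using fun n : ℕ => hcon (4 ^ n) (by positivity)
  have hg (n : ℕ) : ∃ g : E.toSubmodule, (g : Ω →ₘ[μ] ℂ) =ᵐ[μ]
      (fun x => ((‖(f n : Ω →ₘ[μ] ℂ) x‖ : ℝ) : ℂ)) ∧ ‖g‖ ≤ ‖f n‖ :=
    hB.exists_ae_eq (Complex.measurable_ofReal.comp (f n : Ω →ₘ[μ] ℂ).measurable.norm) (f n)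
      (ae_of_all _ fun x => by simp)
  choose g hg hgn using hg
  have := hB.completeSpace
  have hsum : Summable fun n => (((1 / 2 : ℝ) ^ n : ℝ) : ℂ) • g n := by
    refine Summable.of_norm_bounded summable_geometric_two fun n => ?_
    rw [norm_smul, Complex.norm_real, Real.norm_of_nonneg (by positivity)]
    exact mul_le_of_le_one_right (by positivity) ((hgn n).trans (hf1 n))
  obtain ⟨F, hF⟩ := hsum
  -- The terms are nonnegative, so every partial sum beyond `n` dominates the `n`-th term, and the
  -- bound passes to the norm limit.
  have hlarge (n : ℕ) : ∀ᵐ x ∂μ, ‖((((1 / 2 : ℝ) ^ n : ℝ) : ℂ) • (f n : Ω →ₘ[μ] ℂ)) x‖ ≤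
      ‖(F : Ω →ₘ[μ] ℂ) x‖ := by
    refine hB.abs_le_of_tendsto hF.tendsto_sum_nat _ ?_
    filter_upwards [eventually_gt_atTop n] with N hN
    filter_upwards [coeFn_sum_smul hg (fun n => (1 / 2 : ℝ) ^ n) N,
      AEEqFun.coeFn_smul (((1 / 2 : ℝ) ^ n : ℝ) : ℂ) (f n : Ω →ₘ[μ] ℂ)] with x h1 h2
    rw [h1, h2, Pi.smul_apply, norm_smul, Complex.norm_real, Complex.norm_real,
      Real.norm_of_nonneg (by positivity), Real.norm_of_nonneg (by positivity)]
    exact Finset.single_le_sum (f := fun n => (1 / 2 : ℝ) ^ n * ‖(f n : Ω →ₘ[μ] ℂ) x‖)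
      (fun i _ => by positivity) (Finset.mem_range.2 hN)
  have hlow (n : ℕ) : 1 / 2 ≤ μ {x | (2 : ℝ) ^ n ≤ ‖(F : Ω →ₘ[μ] ℂ) x‖} := by
    refine (hf n).le.trans (measure_mono_ae ?_)
    filter_upwards [hlarge n, AEEqFun.coeFn_smul (((1 / 2 : ℝ) ^ n : ℝ) : ℂ)
      (f n : Ω →ₘ[μ] ℂ)] with x h1 h2 (h3 : 4 ^ n < ‖(f n : Ω →ₘ[μ] ℂ) x‖)
    rw [h2, Pi.smul_apply, norm_smul, Complex.norm_real, Real.norm_of_nonneg (by positivity)] at h1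
    refine le_trans ?_ h1
    calc (2 : ℝ) ^ n = (1 / 2) ^ n * 4 ^ n := by rw [← mul_pow]; norm_num
      _ ≤ _ := by gcongr
  have hlim : Tendsto (fun n : ℕ => μ {x | (2 : ℝ) ^ n ≤ ‖(F : Ω →ₘ[μ] ℂ) x‖}) atTop
      (𝓝 (μ (⋂ n : ℕ, {x | (2 : ℝ) ^ n ≤ ‖(F : Ω →ₘ[μ] ℂ) x‖}))) := by
    refine tendsto_measure_iInter_atTop (fun n => (measurableSet_le measurable_const
      (F : Ω →ₘ[μ] ℂ).measurable.norm).nullMeasurableSet) (fun m n hmn x hx => ?_)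
      ⟨0, measure_ne_top _ _⟩
    rw [Set.mem_ofPred_eq] at hx ⊢
    exact (pow_le_pow_right₀ one_le_two hmn).trans hx
  have hempty : (⋂ n : ℕ, {x | (2 : ℝ) ^ n ≤ ‖(F : Ω →ₘ[μ] ℂ) x‖}) = ∅ := by
    refine Set.eq_empty_of_forall_notMem fun x hx => ?_
    obtain ⟨n, hn⟩ := pow_unbounded_of_one_lt ‖(F : Ω →ₘ[μ] ℂ) x‖ one_lt_two
    exact absurd (Set.mem_iInter.1 hx n) (not_le.2 hn)
  rw [hempty, measure_empty] at hlim
  simpa using ge_of_tendsto' hlim hlow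

/-- Homogeneity. The weight `H` is `1` for the embedding in `L¹` and `|g|` for the Köthe pairing. -/
theorem enorm_mul_lintegral_le (hB : E.IsBanachFunctionSpace) {K : ℝ≥0∞} {H : Ω → ℝ≥0∞}
    (hH : Measurable H) (hK : ∀ f : E.toSubmodule, ‖f‖ ≤ 1 →
      ∫⁻ x, ‖(f : Ω →ₘ[μ] ℂ) x‖ₑ * H x ∂μ ≤ K) (f : E.toSubmodule) :
    ∫⁻ x, ‖(f : Ω →ₘ[μ] ℂ) x‖ₑ * H x ∂μ ≤ ‖f‖ₑ * K := by
  rcases eq_or_ne ‖f‖ 0 with h0 | h0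
  · obtain rfl := hB.eq_zero_of_norm_eq_zero f h0
    rw [lintegral_congr_ae (g := fun _ => 0)]
    · simp
    · filter_upwards [AEEqFun.coeFn_zero (α := Ω) (β := ℂ) (μ := μ)] with x hx
      simp [hx]
  · have h1 : ‖((‖f‖⁻¹ : ℝ) : ℂ) • f‖ ≤ 1 := by
      rw [norm_smul, Complex.norm_real, norm_inv, norm_norm, inv_mul_cancel₀ h0]
    have hm : Measurable fun x => ‖(((‖f‖⁻¹ : ℝ) : ℂ) • (f : Ω →ₘ[μ] ℂ)) x‖ₑ * H x :=
      (AEEqFun.measurable _).enorm.mul hH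
    calc ∫⁻ x, ‖(f : Ω →ₘ[μ] ℂ) x‖ₑ * H x ∂μ
        = ∫⁻ x, ‖f‖ₑ * (‖(((‖f‖⁻¹ : ℝ) : ℂ) • (f : Ω →ₘ[μ] ℂ)) x‖ₑ * H x) ∂μ := by
          refine lintegral_congr_ae ?_
          filter_upwards [AEEqFun.coeFn_smul ((‖f‖⁻¹ : ℝ) : ℂ) (f : Ω →ₘ[μ] ℂ)] with x hx
          rw [hx, Pi.smul_apply, ← mul_assoc]
          congr 1
          rw [← ofReal_norm, ← ofReal_norm, ← ofReal_norm, ← ENNReal.ofReal_mul (norm_nonneg _),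
            norm_smul, Complex.norm_real, norm_inv, norm_norm, mul_inv_cancel_left₀ h0]
      _ ≤ ‖f‖ₑ * K := by
          rw [lintegral_const_mul _ hm]
          gcongr
          exact hK _ h1

theorem lintegral_mul_le_kotheNorm (hB : E.IsBanachFunctionSpace) (f : E.toSubmodule)
    (g : Ω →ₘ[μ] ℂ) :
    ∫⁻ x, ‖(f : Ω →ₘ[μ] ℂ) x‖ₑ * ‖g x‖ₑ ∂μ ≤ ‖f‖ₑ * E.kotheNorm g := by
  refine enorm_mul_lintegral_le hB g.measurable.enorm (fun f hf => ?_) f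
  simp_rw [← enorm_mul]
  exact le_iSup₂ (f := fun (f : E.toSubmodule) (_ : ‖f‖ ≤ 1) =>
    ∫⁻ x, ‖(f : Ω →ₘ[μ] ℂ) x * g x‖ₑ ∂μ) f hf

/-- A nonzero Banach function space over a probability space contains a bounded nonnegative
function with positive integral. -/
theorem IsBanachFunctionSpace.exists_bounded_nonneg [IsProbabilityMeasure μ]
    (hB : E.IsBanachFunctionSpace) (hE : E.toSubmodule ≠ ⊥) :
    ∃ (e : E.toSubmodule) (φ : Ω → ℝ), Measurable φ ∧ (∀ x, 0 ≤ φ x) ∧ (∀ x, φ x ≤ 1) ∧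
      (e : Ω →ₘ[μ] ℂ) =ᵐ[μ] (fun x => (φ x : ℂ)) ∧ 0 < ∫ x, φ x ∂μ := by
  obtain ⟨g, hg, hg0⟩ := Submodule.exists_mem_ne_zero_of_ne_bot hE
  have hφ : Measurable fun x => min ‖g x‖ 1 := g.measurable.norm.min measurable_const
  have h0 (x) : 0 ≤ min ‖g x‖ 1 := le_min (norm_nonneg _) zero_le_one
  obtain ⟨e, he, -⟩ := hB.exists_ae_eq (Complex.measurable_ofReal.comp hφ) ⟨g, hg⟩
    (ae_of_all _ fun x => by
      simp [Real.norm_of_nonneg (h0 x)])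
  refine ⟨e, _, hφ, h0, fun x => min_le_right _ _, he, ?_⟩
  refine (integral_nonneg h0).lt_of_ne' fun h => hg0 ?_
  have hi : Integrable (fun x => min ‖g x‖ 1) μ :=
    Integrable.of_bound hφ.aestronglyMeasurable 1 (ae_of_all _ fun x => by
      rw [Real.norm_of_nonneg (h0 x)]
      exact min_le_right _ _)
  rw [integral_eq_zero_iff_of_nonneg h0 hi] at h
  refine AEEqFun.ext ?_
  filter_upwards [h, AEEqFun.coeFn_zero (α := Ω) (β := ℂ) (μ := μ)] with x hx h0
  rw [h0]
  rcases min_choice ‖g x‖ 1 with h' | h' <;> rw [h'] at hx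
  · simpa using hx
  · simp at hx

end SeminormedFunctionSpace

/-! ### Consequences of translation invariance -/

namespace SeminormedFunctionSpace

variable {G : Type u} [AddCommGroup G] [TopologicalSpace G] [IsTopologicalAddGroup G]
  [CompactSpace G] [T2Space G] [MeasurableSpace G] [BorelSpace G]
  {μ : Measure G} [μ.IsAddHaarMeasure] [μ.Regular] [IsProbabilityMeasure μ]
  {E : SeminormedFunctionSpace μ}

/-- Convex combinations of the translates of a bounded function `φ` in a translation invariant
space have bounded norms and approximate the constant `∫ φ`. -/
theorem TranslationInvariant.exists_seq_tendsto_ae (hinv : E.TranslationInvariant)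
    (f : E.toSubmodule) {φ : G → ℝ} (hf : (f : G →ₘ[μ] ℂ) =ᵐ[μ] fun x => (φ x : ℂ))
    {C : ℝ} (hC : ∀ x, ‖φ x‖ ≤ C) :
    ∃ a : ℕ → E.toSubmodule, (∀ n, ‖a n‖ ≤ ‖f‖) ∧
      ∀ᵐ x ∂μ, Tendsto (fun n => (a n : G →ₘ[μ] ℂ) x) atTop (𝓝 ((∫ x, φ x ∂μ : ℝ) : ℂ)) := by
  have hfL : (f : G →ₘ[μ] ℂ) ∈ Lp ℂ 1 μ := by
    rw [Lp.mem_Lp_iff_memLp]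
    refine MemLp.of_bound (f : G →ₘ[μ] ℂ).aestronglyMeasurable C ?_
    filter_upwards [hf] with x hx
    rw [hx, Complex.norm_real]
    exact hC x
  -- Instead of the convex hull of the translates, the integrable part of the `E`-ball of radius
  -- `‖f‖` is used; invariance puts every translate in it.
  have hS : Convex ℝ {u : Lp ℂ 1 μ | ∃ v : E.toSubmodule, (v : G →ₘ[μ] ℂ) = u ∧ ‖v‖ ≤ ‖f‖} := by
    rintro u ⟨v, hv, hvn⟩ u' ⟨v', hv', hvn'⟩ s t hs ht hst
    refine ⟨(s : ℂ) • v + (t : ℂ) • v', ?_, ?_⟩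
    · rw [Submodule.coe_add, Submodule.coe_smul, Submodule.coe_smul, hv, hv']
      rfl
    · refine (norm_add_le _ _).trans ?_
      rw [norm_smul, norm_smul, Complex.norm_real, Complex.norm_real, Real.norm_of_nonneg hs,
        Real.norm_of_nonneg ht]
      calc s * ‖v‖ + t * ‖v'‖ ≤ s * ‖f‖ + t * ‖f‖ := by gcongr
        _ = ‖f‖ := by rw [← add_mul, hst, one_mul]
  obtain ⟨a, ha, hlim⟩ := exists_seq_tendsto_ae_integral hS ⟨f, hfL⟩ fun y => by
    obtain ⟨h, hn⟩ := hinv y f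
    exact ⟨⟨_, h⟩, rfl, hn.le⟩
  choose v hv hvn using ha
  refine ⟨v, hvn, ?_⟩
  simp_rw [hv]
  rwa [← integral_complex_ofReal, ← integral_congr_ae hf]

/-- A translation invariant Banach function space embeds continuously in `L¹`. -/
theorem IsBanachFunctionSpace.exists_lintegral_le (hB : E.IsBanachFunctionSpace)
    (hinv : E.TranslationInvariant) :
    ∃ M : ℝ, 0 ≤ M ∧ ∀ f : E.toSubmodule,
      ∫⁻ x, ‖(f : G →ₘ[μ] ℂ) x‖ₑ ∂μ ≤ ‖f‖ₑ * ENNReal.ofReal M := by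
  obtain ⟨M, hM, hhalf⟩ := hB.exists_measure_le_half
  refine ⟨M, hM, fun f => ?_⟩
  suffices ∀ f : E.toSubmodule, ‖f‖ ≤ 1 →
      ∫⁻ x, ‖(f : G →ₘ[μ] ℂ) x‖ₑ * (fun _ : G => (1 : ℝ≥0∞)) x ∂μ ≤ ENNReal.ofReal M by
    simpa using enorm_mul_lintegral_le hB measurable_const this f
  clear f
  intro f hf1
  simp only [mul_one]
  have htrunc (n : ℕ) : ∫⁻ x, min ‖(f : G →ₘ[μ] ℂ) x‖ₑ n ∂μ ≤ ENNReal.ofReal M := by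
    have h0 (x) : 0 ≤ min ‖(f : G →ₘ[μ] ℂ) x‖ n := le_min (norm_nonneg _) n.cast_nonneg
    have hφ : Measurable fun x => min ‖(f : G →ₘ[μ] ℂ) x‖ n :=
      (f : G →ₘ[μ] ℂ).measurable.norm.min measurable_const
    have hb (x) : ‖min ‖(f : G →ₘ[μ] ℂ) x‖ n‖ ≤ n := by
      rw [Real.norm_of_nonneg (h0 x)]
      exact min_le_right _ _
    have hi : Integrable (fun x => min ‖(f : G →ₘ[μ] ℂ) x‖ n) μ :=
      Integrable.of_bound hφ.aestronglyMeasurable n (ae_of_all _ hb)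
    obtain ⟨h, hh, hhn⟩ := hB.exists_ae_eq (Complex.measurable_ofReal.comp hφ) f
      (ae_of_all _ fun x => by
        rw [Function.comp_apply, Complex.norm_real, Real.norm_of_nonneg (h0 x)]
        exact min_le_left _ _)
    obtain ⟨a, ha, hlim⟩ := hinv.exists_seq_tendsto_ae h hh hb
    -- Each `a k` is in the unit ball, so `|a k| ≤ M` on a set of measure at least `1/2`. If the
    -- integral exceeded `M`, then `a k` would stay a fixed distance from its limit there, against
    -- convergence in measure.
    have hle : ∫ x, min ‖(f : G →ₘ[μ] ℂ) x‖ n ∂μ ≤ M := by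
      by_contra! hlt
      have hmeas := tendstoInMeasure_iff_norm.1 (tendstoInMeasure_of_tendsto_ae
        (fun k => (a k : G →ₘ[μ] ℂ).aestronglyMeasurable) hlim) _ (sub_pos.2 hlt)
      have hhalf' (k : ℕ) : 1 / 2 ≤ μ {x | ∫ x, min ‖(f : G →ₘ[μ] ℂ) x‖ n ∂μ - M ≤
          ‖(a k : G →ₘ[μ] ℂ) x - ((∫ x, min ‖(f : G →ₘ[μ] ℂ) x‖ n ∂μ : ℝ) : ℂ)‖} := by
        have hk := hhalf (a k) ((ha k).trans (hhn.trans hf1))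
        have hc : μ {x | M < ‖(a k : G →ₘ[μ] ℂ) x‖}ᶜ = 1 - μ {x | M < ‖(a k : G →ₘ[μ] ℂ) x‖} :=
          prob_compl_eq_one_sub
            (measurableSet_lt measurable_const (a k : G →ₘ[μ] ℂ).measurable.norm)
        calc (1 / 2 : ℝ≥0∞) = 1 - 1 / 2 := by simp
          _ ≤ μ {x | M < ‖(a k : G →ₘ[μ] ℂ) x‖}ᶜ := by
            rw [hc]
            exact tsub_le_tsub_left hk 1
          _ ≤ _ := by
            refine measure_mono fun x hx => ?_
            simp only [Set.mem_compl_iff, Set.mem_ofPred_eq, not_lt] at hx ⊢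
            rw [norm_sub_rev]
            refine le_trans ?_ (norm_sub_norm_le _ _)
            rw [Complex.norm_real, Real.norm_of_nonneg (integral_nonneg h0)]
            linarith
      simpa using ge_of_tendsto' hmeas hhalf'
    calc ∫⁻ x, min ‖(f : G →ₘ[μ] ℂ) x‖ₑ n ∂μ
        = ∫⁻ x, ENNReal.ofReal (min ‖(f : G →ₘ[μ] ℂ) x‖ n) ∂μ := by
          refine lintegral_congr fun x => ?_
          rw [ENNReal.ofReal_min, ofReal_norm, ENNReal.ofReal_natCast]
      _ = ENNReal.ofReal (∫ x, min ‖(f : G →ₘ[μ] ℂ) x‖ n ∂μ) :=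
          (ofReal_integral_eq_lintegral_ofReal hi (ae_of_all _ h0)).symm
      _ ≤ _ := ENNReal.ofReal_le_ofReal hle
  calc ∫⁻ x, ‖(f : G →ₘ[μ] ℂ) x‖ₑ ∂μ = ∫⁻ x, ⨆ n : ℕ, min ‖(f : G →ₘ[μ] ℂ) x‖ₑ n ∂μ := by
        refine lintegral_congr fun x => ?_
        rw [← inf_iSup_eq, ENNReal.iSup_natCast, inf_top_eq]
    _ = ⨆ n : ℕ, ∫⁻ x, min ‖(f : G →ₘ[μ] ℂ) x‖ₑ n ∂μ :=
        lintegral_iSup (fun n => (f : G →ₘ[μ] ℂ).measurable.enorm.min measurable_const)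
          fun m n hmn x => min_le_min_left _ (Nat.cast_le.2 hmn)
    _ ≤ _ := iSup_le htrunc

/-- The Köthe dual of a nonzero translation invariant Banach function space embeds continuously in
`L¹`. -/
theorem IsBanachFunctionSpace.exists_lintegral_le_kotheNorm (hB : E.IsBanachFunctionSpace)
    (hE : E.toSubmodule ≠ ⊥) (hinv : E.TranslationInvariant) :
    ∃ C : ℝ≥0∞, C ≠ ∞ ∧ ∀ g : G →ₘ[μ] ℂ, ∫⁻ x, ‖g x‖ₑ ∂μ ≤ C * E.kotheNorm g := by
  obtain ⟨e, φ, -, h0, h1, he, hpos⟩ := hB.exists_bounded_nonneg hE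
  obtain ⟨a, ha, hlim⟩ := hinv.exists_seq_tendsto_ae e he (C := 1) fun x => by
    rw [Real.norm_of_nonneg (h0 x)]
    exact h1 x
  set c : ℂ := ((∫ x, φ x ∂μ : ℝ) : ℂ)
  have hc : ‖c‖ₑ ≠ 0 := by simpa [c] using hpos.ne'
  refine ⟨‖c‖ₑ⁻¹ * ‖e‖ₑ, ENNReal.mul_ne_top (ENNReal.inv_ne_top.2 hc) enorm_ne_top, fun g => ?_⟩
  have key : ‖c‖ₑ * ∫⁻ x, ‖g x‖ₑ ∂μ ≤ ‖e‖ₑ * E.kotheNorm g := by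
    calc ‖c‖ₑ * ∫⁻ x, ‖g x‖ₑ ∂μ = ∫⁻ x, ‖c * g x‖ₑ ∂μ := by
          simp_rw [enorm_mul]
          rw [lintegral_const_mul _ g.measurable.enorm]
      _ = ∫⁻ x, liminf (fun n => ‖(a n : G →ₘ[μ] ℂ) x * g x‖ₑ) atTop ∂μ := by
          refine lintegral_congr_ae ?_
          filter_upwards [hlim] with x hx
          exact ((hx.mul_const (g x)).enorm).liminf_eq.symm
      _ ≤ liminf (fun n => ∫⁻ x, ‖(a n : G →ₘ[μ] ℂ) x * g x‖ₑ ∂μ) atTop :=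
          lintegral_liminf_le fun n => ((a n : G →ₘ[μ] ℂ).measurable.mul g.measurable).enorm
      _ ≤ liminf (fun _ : ℕ => ‖e‖ₑ * E.kotheNorm g) atTop := by
          refine liminf_le_liminf (Eventually.of_forall fun n => ?_)
          simp_rw [enorm_mul]
          refine (lintegral_mul_le_kotheNorm hB (a n) g).trans ?_
          gcongr
          rw [← ofReal_norm, ← ofReal_norm]
          exact ENNReal.ofReal_le_ofReal (ha n)
      _ = _ := liminf_const _
  calc ∫⁻ x, ‖g x‖ₑ ∂μ = ‖c‖ₑ⁻¹ * (‖c‖ₑ * ∫⁻ x, ‖g x‖ₑ ∂μ) := by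
        rw [← mul_assoc, ENNReal.inv_mul_cancel hc enorm_ne_top, one_mul]
    _ ≤ _ := by
        rw [mul_assoc]
        gcongr

/-- A nonzero translation invariant Banach function space with the Fatou property contains a
function that is bounded away from zero. -/
theorem FatouProperty.exists_le_norm (hF : E.FatouProperty) (hB : E.IsBanachFunctionSpace)
    (hE : E.toSubmodule ≠ ⊥) (hinv : E.TranslationInvariant) :
    ∃ (w : E.toSubmodule) (c : ℝ), 0 < c ∧ ∀ᵐ x ∂μ, c ≤ ‖(w : G →ₘ[μ] ℂ) x‖ := by
  obtain ⟨e, φ, -, h0, h1, he, hpos⟩ := hB.exists_bounded_nonneg hE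
  obtain ⟨a, ha, hlim⟩ := hinv.exists_seq_tendsto_ae e he (C := 1) fun x => by
    rw [Real.norm_of_nonneg (h0 x)]
    exact h1 x
  have hbdd (n : ℕ) (x : G) : BddBelow (Set.range fun k => ‖(a (n + k) : G →ₘ[μ] ℂ) x‖) :=
    ⟨0, Set.forall_mem_range.2 fun _ => norm_nonneg _⟩
  have hnonneg (n : ℕ) (x : G) : 0 ≤ ⨅ k, ‖(a (n + k) : G →ₘ[μ] ℂ) x‖ :=
    Real.iInf_nonneg fun _ => norm_nonneg _
  -- The averages need not be monotone; their tail infima are, lie below `|a n|`, and have the same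
  -- limit.
  have hu (n : ℕ) : ∃ u : E.toSubmodule, (u : G →ₘ[μ] ℂ) =ᵐ[μ]
      (fun x => ((⨅ k, ‖(a (n + k) : G →ₘ[μ] ℂ) x‖ : ℝ) : ℂ)) ∧ ‖u‖ ≤ ‖a n‖ := by
    refine hB.exists_ae_eq (Complex.measurable_ofReal.comp (Measurable.iInf fun k =>
      (a (n + k) : G →ₘ[μ] ℂ).measurable.norm)) (a n) (ae_of_all _ fun x => ?_)
    rw [Function.comp_apply, Complex.norm_real, Real.norm_of_nonneg (hnonneg n x)]
    exact ciInf_le (hbdd n x) 0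
  choose u hu hun using hu
  -- `ULift` moves the index set `ℕ` into the universe of `G`.
  obtain ⟨w, hw, -⟩ := hF (ULift.{u} ℕ) (fun n => u n.down)
    (fun n => by
      rw [← AEEqFun.coeFn_le]
      filter_upwards [hu n.down, AEEqFun.coeFn_zero (α := G) (β := ℂ) (μ := μ)] with x hx hx0
      rw [hx, hx0]
      exact Complex.zero_le_real.2 (hnonneg _ _))
    (fun m n hmn => by
      rw [← AEEqFun.coeFn_le]
      filter_upwards [hu m.down, hu n.down] with x hm hn
      rw [hm, hn, Complex.real_le_real]
      refine le_ciInf fun k => ?_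
      obtain ⟨d, hd⟩ := Nat.exists_eq_add_of_le (show m.down ≤ n.down from hmn)
      rw [hd, add_assoc]
      exact ciInf_le (hbdd _ x) (d + k))
    ⟨‖e‖, Set.forall_mem_range.2 fun n => (hun _).trans (ha _)⟩
  refine ⟨w, _, hpos, ?_⟩
  have hle : ∀ᵐ x ∂μ, ∀ n : ℕ, (u n : G →ₘ[μ] ℂ) x ≤ (w : G →ₘ[μ] ℂ) x :=
    ae_all_iff.2 fun n => AEEqFun.coeFn_le.2 (hw.1 ⟨⟨n⟩, rfl⟩)
  filter_upwards [hle, ae_all_iff.2 hu, hlim] with x hx hux hax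
  refine le_of_forall_lt fun b hb => ?_
  obtain ⟨b', hb, hb'⟩ := exists_between hb
  have hnorm := hax.norm
  rw [Complex.norm_real, Real.norm_of_nonneg hpos.le] at hnorm
  obtain ⟨n, hn⟩ := eventually_atTop.1 (hnorm.eventually (lt_mem_nhds hb'))
  have h2 := (Complex.le_def.1 (hx n)).1
  rw [hux n, Complex.ofReal_re] at h2
  calc b < b' := hb
    _ ≤ ⨅ k, ‖(a (n + k) : G →ₘ[μ] ℂ) x‖ := le_ciInf fun k => (hn _ (Nat.le_add_right _ _)).le
    _ ≤ _ := h2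
    _ ≤ _ := Complex.re_le_norm _

end SeminormedFunctionSpace

/-! ### The four inclusions -/

open SeminormedFunctionSpace in
theorem corollary3p5 {G : Type u} [AddCommGroup G] [TopologicalSpace G] [IsTopologicalAddGroup G]
    [CompactSpace G] [T2Space G] [Infinite G] [MeasurableSpace G] [BorelSpace G]
    (μ : Measure G) [μ.IsAddHaarMeasure] [μ.Regular] [IsProbabilityMeasure μ]
    (E : SeminormedFunctionSpace μ)
    (hB : E.IsBanachFunctionSpace) (hE : E.toSubmodule ≠ ⊥) (hinv : E.TranslationInvariant) :
    ((lpFunctionSpace ∞ μ).ContinuouslyIncluded E.kotheDual ∧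
      E.kotheDual.ContinuouslyIncluded (lpFunctionSpace 1 μ)) ∧
    (E.FatouProperty →
      (lpFunctionSpace ∞ μ).ContinuouslyIncluded E ∧ E.ContinuouslyIncluded (lpFunctionSpace 1 μ)) := by
  obtain ⟨M, hM, hL1⟩ := hB.exists_lintegral_le hinv
  obtain ⟨C, hC, hdual⟩ := hB.exists_lintegral_le_kotheNorm hE hinv
  refine ⟨⟨?_, ?_⟩, fun hF => ⟨?_, ?_⟩⟩
  · have hbound (g : (lpFunctionSpace ∞ μ).toSubmodule) :
        E.kotheNorm (g : G →ₘ[μ] ℂ) ≤ ENNReal.ofReal (M * ‖g‖) := by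
      refine iSup₂_le fun f hf => ?_
      calc ∫⁻ x, ‖(f : G →ₘ[μ] ℂ) x * (g : G →ₘ[μ] ℂ) x‖ₑ ∂μ
          ≤ ∫⁻ x, ‖(f : G →ₘ[μ] ℂ) x‖ₑ * ENNReal.ofReal ‖g‖ ∂μ := by
            refine lintegral_mono_ae ?_
            filter_upwards [ae_norm_le_lpFunctionSpace_top g] with x hx
            rw [enorm_mul, ← ofReal_norm ((g : G →ₘ[μ] ℂ) x)]
            gcongr
        _ = (∫⁻ x, ‖(f : G →ₘ[μ] ℂ) x‖ₑ ∂μ) * ENNReal.ofReal ‖g‖ :=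
            lintegral_mul_const _ (f : G →ₘ[μ] ℂ).measurable.enorm
        _ ≤ 1 * ENNReal.ofReal M * ENNReal.ofReal ‖g‖ := by
            gcongr
            refine (hL1 f).trans ?_
            gcongr
            rw [← ofReal_norm]
            exact ENNReal.ofReal_le_one.2 hf
        _ = _ := by rw [one_mul, ENNReal.ofReal_mul hM]
    refine continuouslyIncluded_of_bound
      (fun g hg => (hbound ⟨g, hg⟩).trans_lt ENNReal.ofReal_lt_top) M fun g => ?_
    rw [norm_kotheDual]
    exact ENNReal.toReal_le_of_le_ofReal (by positivity) (hbound g)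
  · refine continuouslyIncluded_of_bound (fun g hg => mem_lpFunctionSpace_one
      ((hdual g).trans_lt (ENNReal.mul_lt_top hC.lt_top hg))) C.toReal fun g => ?_
    rw [lpFunctionSpace_one_norm, norm_kotheDual, ← ENNReal.toReal_mul]
    exact ENNReal.toReal_mono (ENNReal.mul_lt_top hC.lt_top g.2).ne (hdual g)
  · obtain ⟨w, c, hc, hw⟩ := hF.exists_le_norm hB hE hinv
    -- Since `|w| ≥ c`, the multiple `(‖g‖ / c) w` dominates `g`; this gives both membership in `E`
    -- and the constant `‖w‖ / c`.
    have hle (g : (lpFunctionSpace ∞ μ).toSubmodule) : ∀ᵐ x ∂μ, ‖(g : G →ₘ[μ] ℂ) x‖ ≤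
        ‖((((‖g‖ / c : ℝ) : ℂ) • w : E.toSubmodule) : G →ₘ[μ] ℂ) x‖ := by
      rw [Submodule.coe_smul]
      filter_upwards [ae_norm_le_lpFunctionSpace_top g, hw,
        AEEqFun.coeFn_smul ((‖g‖ / c : ℝ) : ℂ) (w : G →ₘ[μ] ℂ)] with x h1 h2 h3
      rw [h3, Pi.smul_apply, norm_smul, Complex.norm_real, Real.norm_of_nonneg (by positivity)]
      calc _ ≤ ‖g‖ := h1
        _ = ‖g‖ / c * c := by field_simp
        _ ≤ _ := by gcongr
    have hsub : (lpFunctionSpace ∞ μ).toSubmodule ≤ E.toSubmodule := fun g hg =>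
      hB.mem_of_abs_le _ _ (Subtype.property _) (hle ⟨g, hg⟩)
    refine continuouslyIncluded_of_bound hsub (‖w‖ / c) fun g => ?_
    refine (hB.norm_le_of_abs_le _ _ (hle g)).trans_eq ?_
    rw [norm_smul, Complex.norm_real, Real.norm_of_nonneg (by positivity)]
    ring
  · have hfin (f : E.toSubmodule) : ‖f‖ₑ * ENNReal.ofReal M < ∞ :=
      ENNReal.mul_lt_top enorm_lt_top ENNReal.ofReal_lt_top
    refine continuouslyIncluded_of_bound
      (fun f hf => mem_lpFunctionSpace_one ((hL1 ⟨f, hf⟩).trans_lt (hfin _))) M fun f => ?_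
    rw [lpFunctionSpace_one_norm]
    refine (ENNReal.toReal_mono (hfin f).ne (hL1 f)).trans_eq ?_
    rw [ENNReal.toReal_mul, ENNReal.toReal_ofReal hM, toReal_enorm, mul_comm]
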